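/- Let $k\ge 1$, $\alpha\ge 1$ be integers with $k\le \alpha+2$, put $d=\alpha+k-1$ (so that $k\le\alpha+2$ means $d\ge 2k-3$), and let $n>d$. A file consists of $B=k\alpha$ symbols of a finite field $\mathbb F_q$, written as column vectors $z_1,\dots,z_k\in\mathbb F_q^{\alpha}$. In a linear code, node $m\in\{1,\dots,n\}$ stores the $\alpha$ symbols $\sum_{l=1}^k G^{(m)}_l z_l$ with $G^{(m)}_l\in\mathbb F_q^{\alpha\times\alpha}$, that is, it stores the $\alpha\times B$ matrix $\mathbf G^{(m)}=[G^{(m)}_1\ \cdots\ G^{(m)}_k]$; nodes $1,\dots,k$ are systematic: $G^{(m)}_m=I$ and $G^{(m)}_l=0$ for $l\ne m$, $m\le k$. A code of this kind, with $\alpha$ symbols per node and with $\beta$ symbols passed by each helper, is called an *optimal exact regenerating code* if (i) (reconstruction) the matrices stored by any $k$ nodes, placed one below the other, form a $B\times B$ matrix of full rank; (ii) (exact regeneration) there are matrices $X^{(m,l)}\in\mathbb F_q^{\beta\times\alpha}$ (the coefficients of the $\beta$ symbols which node $m$ passes for the regeneration of systematic node $l$) such that for every systematic node $l$ and every set $D$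 of $d$ nodes with $l\notin D$ there are matrices $Y_m\in\mathbb F_q^{\alpha\times\beta}$, $m\in D$, with $\sum_{m\in D}Y_mX^{(m,l)}\mathbf G^{(m)}=\mathbf G^{(l)}$; (iii) the lower bound $d\beta\ge\alpha+(k-1)\beta$ on the repair bandwidth holds with equality. Then there is a number $q_0$, depending only on $n,k,\alpha$, such that over every finite field $\mathbb F_q$ with $q\ge q_0$ there is an optimal exact regenerating code with $\beta=1$, with passed coefficients $x^{(m,l)}\in\mathbb F_q^{\alpha}$, which has the following structure: for $m=k+1,\dots,n$ and $j=1,\dots,k$, $G^{(m)}_j=\Lambda^{(m)}_jH^{(m)}_j$, where $\Lambda^{(m)}_j=\mathrm{diag}(\lambda^{(m)}_{1,j},\dots,\lambda^{(m)}_{\alpha,j})$ with $\lambda^{(m)}_{i,i}=1$ for $i\le\min(k,\alpha)$; for $i\neq j$ the $i$-th row of $H^{(m)}_j$ does not depend on $m$ (interference alignment); and $x^{(m,l)}=e_l$ (the $l$-th unit vector) for $l\le\min(k,\alpha)$ and $m>k$. Moreover, for every $\beta\ge1$, splitting a file of $\beta k\alpha$ symbols into $\beta$ chunks of $k\alpha$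 symbols and applying this code and its regeneration procedure to each chunk separately gives an optimal exact regenerating code with $\beta\alpha$ symbols per node in which each of the $d$ helpers passes $\beta$ symbols. -/

import Mathlib

namespace RegenCode

/-- The storage nodes: `k` systematic nodes (`Sum.inl`) and `r` non-systematic nodes (`Sum.inr`). -/
abbrev Node (k r : ℕ) : Type := Fin k ⊕ Fin r

/-- A linear storage code in which every node stores one symbol for each element of `S` (so
`α = |S|`) and the file consists of `k` vectors `z_1, …, z_k` with entries indexed by `S`
(so `B = k * |S|`).  `G m l` is the block of coefficients with which `z_l` enters the content of
node `m`: node `m` stores `∑ l, G m l * z_l`. -/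
abbrev Code (F : Type*) (k r : ℕ) (S : Type*) : Type _ :=
  Node k r → Fin k → Matrix S S F

/-- Coefficients of the passed symbols: for the regeneration of systematic node `l`, node `m`
passes one linear combination of its stored symbols for each element of `T` (so `β = |T|`); the
coefficients of these combinations are the rows of `X m l`. -/
abbrev Passing (F : Type*) (k r : ℕ) (S T : Type*) : Type _ :=
  Node k r → Fin k → Matrix T S F

section

variable {F : Type*} [Field F] {k r : ℕ} {S T : Type*}

/-- The full matrix `[G m 1, …, G m k]`, of size `α × B`, stored by node `m`. -/
def nodeMatrix (G : Code F k r S) (m : Node k r) : Matrix S (Fin k × S) F :=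
  Matrix.of fun a p => G m p.1 a p.2

/-- Systematic node `m` stores `z_m` in uncoded form. -/
def IsSystematic [DecidableEq S] (G : Code F k r S) : Prop :=
  ∀ m l : Fin k, G (Sum.inl m) l = if l = m then 1 else 0

/-- The matrices stored by the nodes in `K`, juxtaposed one below the other. -/
def stackedMatrix (G : Code F k r S) (K : Finset (Node k r)) :
    Matrix ({m // m ∈ K} × S) (Fin k × S) F :=
  Matrix.of fun p => nodeMatrix G p.1.1 p.2

/-- Reconstruction: the matrices stored by any `k` nodes form a `B × B` matrix of full rank. -/
def Reconstructs [Fintype S] (G : Code F k r S) : Prop :=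
  ∀ K : Finset (Node k r), K.card = k → (stackedMatrix G K).rank = k * Fintype.card S

/-- Exact regeneration of the systematic nodes: for every systematic node `l` and every set `D` of
`d` other nodes, the content of node `l` is obtained by linear operations (the matrices `Y m`) from
the vectors passed by the nodes in `D`.  What a node passes for `l` does not depend on `D`. -/
def RegeneratesSystematic [Fintype S] [Fintype T] (G : Code F k r S) (X : Passing F k r S T)
    (d : ℕ) : Prop :=
  ∀ (l : Fin k) (D : Finset (Node k r)), D.card = d → Sum.inl l ∉ D →
    ∃ Y : Node k r → Matrix S T F,
      ∑ m ∈ D, Y m * (X m l * nodeMatrix G m) = nodeMatrix G (Sum.inl l)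

/-- Optimal exact regeneration: a systematic linear code with the reconstruction property and exact
regeneration of the systematic nodes from any `d` nodes, meeting the lower bound
`d * β ≥ α + (k - 1) * β` on the repair bandwidth with equality (`β` is added on both sides). -/
def IsOptimalExactRegenerating [Fintype S] [DecidableEq S] [Fintype T] (G : Code F k r S)
    (X : Passing F k r S T) (d : ℕ) : Prop :=
  IsSystematic G ∧ Reconstructs G ∧ RegeneratesSystematic G X d ∧
    d * Fintype.card T + Fintype.card T = Fintype.card S + k * Fintype.card T

/-- Splitting the file into `β` chunks and encoding each of them by the code `G`: the node blocks
are block diagonal with `β` equal blocks. -/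
def chunk (β : ℕ) (G : Code F k r S) : Code F k r (Fin β × S) :=
  fun m l => Matrix.kroneckerMap (· * ·) (1 : Matrix (Fin β) (Fin β) F) (G m l)

/-- The regeneration is performed separately on each of the `β` chunks. -/
def chunkPassing (β : ℕ) (X : Passing F k r S T) : Passing F k r (Fin β × S) (Fin β × T) :=
  fun m l => Matrix.kroneckerMap (· * ·) (1 : Matrix (Fin β) (Fin β) F) (X m l)

end

/-- The structure of the code.  For every non-systematic node `m`:
* `G_j^(m) = Λ_j^(m) H_j^(m)` with `Λ_j^(m)` diagonal, where `lam m j i` is the `i`-th diagonal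
  entry of `Λ_j^(m)` and `H m j i` is the `i`-th row of `H_j^(m)`;
* the `i`-th diagonal entry of `Λ_i^(m)` is `1`;
* for `i ≠ j` the `i`-th row of `H_j^(m)` is the same for all `m` (alignment);
* for the regeneration of systematic node `l`, with `l` at most `α`, node `m` passes the `l`-th
  row of its matrix. -/
def HasAlignedStructure {F : Type*} [Field F] {k r α : ℕ} (G : Code F k r (Fin α))
    (X : Passing F k r (Fin α) (Fin 1)) : Prop :=
  ∃ (lam : Fin r → Fin k → Fin α → F) (H : Fin r → Fin k → Matrix (Fin α) (Fin α) F),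
    (∀ m j, G (Sum.inr m) j = Matrix.diagonal (lam m j) * H m j) ∧
    (∀ m (j : Fin k) (i : Fin α), (i : ℕ) = j → lam m j i = 1) ∧
    (∀ m m' (j : Fin k) (i : Fin α), (i : ℕ) ≠ j → H m j i = H m' j i) ∧
    (∀ m (l : Fin k) (i : Fin α), (i : ℕ) = l → X (Sum.inr m) l 0 = Pi.single i 1)

end RegenCode

namespace RegenCode

/-! Index the systematic nodes by `S ⊕ Bool`, which has `α + 2` elements; this is where `k ≤ α + 2`
enters. A non-systematic node is given by a vector `a` and one scalar per block. To repair node `l`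
with `l ≤ α` it passes row `l`; for the two extra nodes it passes its stored symbols combined with
coefficients `1`, respectively `a`. The blocks are chosen so that the interference of any other
systematic node always lies along a direction not involving `a` (`passed_vecMul_block`). Hence each
interfering node costs one unknown, not `α`. A systematic helper passes exactly its aligned
direction and removes its own interference. With `s` systematic helpers there remain `α` desired
unknowns and `k - 1 - s` interferences, against `d - s = α + k - 1 - s` equations: a square system.
Reconstruction is likewise a square system in the blocks of the missing systematic nodes. It remains
to make finitely many determinants nonzero at once. They are integer polynomials in the parameters.
Over a large field each is nonzero somewhere, since setting most scalars to zero makes its matrix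
diagonal or block diagonal; then `exists_point_forall_eval_ne_zero` gives a common point. -/

open Finset

/-! ### Common nonzeros of finitely many polynomials over large fields. -/

section Nonvanishing

/-- Finitely many integer polynomials, none of which vanishes identically on a large finite field
`F`, have a common point over `F` at which none of them vanishes. -/
theorem exists_point_forall_eval_ne_zero {σ ι : Type} [Finite σ] [Finite ι]
    (P : ι → MvPolynomial σ ℤ) :
    ∃ q₀ : ℕ, ∀ (F : Type*) [Field F] [Fintype F], q₀ ≤ Fintype.card F →
      (∀ c, ∃ x : σ → F, MvPolynomial.eval₂ (Int.castRingHom F) x (P c) ≠ 0) →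
      ∃ x : σ → F, ∀ c, MvPolynomial.eval₂ (Int.castRingHom F) x (P c) ≠ 0 := by
  classical
  have := Fintype.ofFinite ι
  -- Mapping coefficients to `F` cannot raise degrees, so the degree over `ℤ` gives a bound uniform
  -- in `F`.
  refine ⟨(∏ c, P c).totalDegree + 1, fun F _ _ hF h => ?_⟩
  by_contra! hx
  have hzero : MvPolynomial.map (Int.castRingHom F) (∏ c, P c) = 0 := by
    refine MvPolynomial.eq_zero_of_eval_zero_at_prod_finset _ (fun _ => Finset.univ) (fun i => ?_)
      fun x _ => ?_
    · refine lt_of_le_of_lt (MvPolynomial.degreeOf_le_totalDegree _ i) ?_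
      refine lt_of_le_of_lt (Finset.sup_mono (MvPolynomial.support_map_subset _ _)) ?_
      rw [Finset.card_univ]
      exact hF
    · obtain ⟨c, hc⟩ := hx x
      rw [MvPolynomial.eval_map, MvPolynomial.eval₂_prod]
      exact Finset.prod_eq_zero (Finset.mem_univ c) hc
  rw [map_prod, Finset.prod_eq_zero_iff] at hzero
  obtain ⟨c, -, hc⟩ := hzero
  obtain ⟨x, hx⟩ := h c
  rw [← MvPolynomial.eval_map, hc] at hx
  simp at hx

end Nonvanishing

/-! ### The blocks, the passed symbols and interference alignment. -/

section Blocks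

variable {R R' : Type*} [CommRing R] [CommRing R'] {S : Type*} [Fintype S] [DecidableEq S]

/-- The product of the differences `a j - a i` over all `i ≠ j`. -/
def diffProd (a : S → R) (j : S) : R :=
  ∏ i ∈ univ.erase j, (a j - a i)

/-- The product of the differences `a j - a i'` over all `i'` other than `j` and `i`. -/
def diffProdErase (a : S → R) (j i : S) : R :=
  ∏ i' ∈ (univ.erase j).erase i, (a j - a i')

theorem sub_mul_diffProdErase (a : S → R) {j i : S} (h : i ≠ j) :
    (a j - a i) * diffProdErase a j i = diffProd a j :=
  Finset.mul_prod_erase _ (fun i' => a j - a i') (Finset.mem_erase.2 ⟨h, Finset.mem_univ i⟩)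

/-- The blocks of a non-systematic node with parameter vector `a`, up to scalar factors. -/
def block (a : S → R) : S ⊕ Bool → Matrix S S R
  | .inl j => Matrix.of fun i i' =>
      if i = j then (if i' = j then diffProd a j else -(a j * diffProdErase a j i'))
      else if i' = i then a j * diffProdErase a j i else 0
  | .inr false => Matrix.diagonal fun i => ∏ i' ∈ univ.erase i, a i'
  | .inr true => 1

/-- The coefficients of the symbol which a non-systematic node passes for a systematic one. -/
def passed (a : S → R) : S ⊕ Bool → S → R
  | .inl l => Pi.single l 1
  | .inr false => 1
  | .inr true => a

/-- The direction in which the interference of the second node is aligned in the regeneration of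
the first. -/
def direction : S ⊕ Bool → S ⊕ Bool → S → R
  | .inl l, _ => Pi.single l 1
  | .inr false, .inl j => Pi.single j 1
  | .inr true, .inl j => fun i => if i = j then 1 else -1
  | .inr _, .inr _ => 1

/-- The coefficient of the interference of the second node in the regeneration of the first. -/
def interference (a : S → R) : S ⊕ Bool → S ⊕ Bool → R
  | .inl l, .inl j => a j * diffProdErase a j l
  | .inl l, .inr false => ∏ i' ∈ univ.erase l, a i'
  | .inl _, .inr true => 1
  | .inr false, .inl j => diffProd a j
  | .inr true, .inl j => a j * diffProd a j
  | .inr false, .inr _ => 1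
  | .inr true, .inr _ => ∏ i, a i

/-- By `key`, column `i ≠ j` of block `j` sees `f` only through `f i - f j`. For a unit vector `f =
e_l` with `l ≠ j` only column `l` survives; for `f = 1` only column `j`; for `f = a` the factor `a i
- a j` completes `diffProdErase` to `-diffProd`, so all columns agree up to sign. -/
theorem passed_vecMul_block (a : S → R) {t t' : S ⊕ Bool} (h : t ≠ t') :
    Matrix.vecMul (passed a t) (block a t') = interference a t t' • direction t t' := by
  have key : ∀ (f : S → R) (j : S), Matrix.vecMul f (block a (.inl j)) =
      fun i => if i = j then f j * diffProd a j
        else (f i - f j) * (a j * diffProdErase a j i) := by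
    intro f j
    ext i
    simp only [Matrix.vecMul, dotProduct, block, Matrix.of_apply]
    by_cases hi : i = j
    · subst hi
      rw [Finset.sum_eq_single i]
      · simp
      · intro b _ hb
        simp [hb, hb.symm]
      · simp
    · rw [Finset.sum_eq_add_of_mem i j (Finset.mem_univ _) (Finset.mem_univ _) hi]
      · simp [hi]; ring
      · rintro c - ⟨h1, h2⟩
        simp [h2, h1.symm]
  ext i
  match t, t' with
  | .inl l, .inl j =>
    have hl : l ≠ j := fun e => h (by rw [e])
    rw [key]
    by_cases hi : i = j
    · subst hi
      simp [passed, direction, hl.symm]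
    · by_cases hil : i = l
      · subst hil
        simp [passed, interference, direction, hi]
      · simp [passed, interference, direction, hi, hil, hl.symm]
  | .inl l, .inr false =>
    by_cases hil : i = l
    · subst hil; simp [passed, interference, direction, block]
    · simp [passed, interference, direction, block, hil]
  | .inl l, .inr true => simp [passed, interference, direction, block]
  | .inr false, .inl j =>
    rw [key]
    by_cases hi : i = j
    · subst hi; simp [passed, interference, direction]
    · simp [passed, interference, direction, hi]
  | .inr true, .inl j =>
    rw [key]
    by_cases hi : i = j
    · subst hi; simp [passed, interference, direction]
    · simp only [passed, interference, direction, hi, if_false, Pi.smul_apply, smul_eq_mul,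
        ← sub_mul_diffProdErase a hi]
      ring
  | .inr false, .inr false => exact absurd rfl h
  | .inr true, .inr true => exact absurd rfl h
  | .inr false, .inr true => simp [passed, interference, direction, block]
  | .inr true, .inr false =>
    simp [passed, interference, direction, block, Matrix.vecMul_diagonal,
      Finset.mul_prod_erase]

/-- The coordinates of the symbol passed for the regeneration of `t` by a node with parameters `p`:
first the desired ones, then the coefficients of the interferences. -/
def feature (p : S ⊕ (S ⊕ Bool) → R) (t : S ⊕ Bool) : S ⊕ (S ⊕ Bool) → R
  | .inl i => p (.inr t) * Matrix.vecMul (passed (p ∘ .inl) t) (block (p ∘ .inl) t) i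
  | .inr t' => p (.inr t') * interference (p ∘ .inl) t t'

/-- The features of the nodes `e c`, restricted to the coordinates in `Q`. -/
def featureMatrix {r : ℕ} (p : Fin r → S ⊕ (S ⊕ Bool) → R) (t : S ⊕ Bool)
    (Q : Finset (S ⊕ (S ⊕ Bool))) (e : Q → Fin r) : Matrix Q Q R :=
  Matrix.of fun c c' => feature (p (e c)) t c'

/-- The blocks of the nodes `e t`, restricted to the systematic nodes in `Q`. -/
def blockMatrix {r : ℕ} (p : Fin r → S ⊕ (S ⊕ Bool) → R)
    (Q : Finset (S ⊕ Bool)) (e : Q → Fin r) : Matrix (S × Q) (S × Q) R :=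
  Matrix.of fun x y => p (e x.2) (.inr y.2) * block (p (e x.2) ∘ .inl) y.2 x.1 y.1

/-! ### Compatibility with ring homomorphisms, used to specialise indeterminates to field elements.
-/

section Naturality

variable (φ : R →+* R')

theorem map_block (a : S → R) (t : S ⊕ Bool) (i i' : S) :
    φ (block a t i i') = block (φ ∘ a) t i i' := by
  match t with
  | .inl j =>
    simp only [block, Matrix.of_apply, diffProd, diffProdErase, Function.comp]
    split_ifs <;> simp
  | .inr false => simp only [block, Matrix.diagonal_apply]; split_ifs <;> simp
  | .inr true => simp only [block, Matrix.one_apply]; split_ifs <;> simp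

omit [Fintype S] in
theorem map_passed (a : S → R) (t : S ⊕ Bool) (i : S) :
    φ (passed a t i) = passed (φ ∘ a) t i := by
  match t with
  | .inl j => simp only [passed, Pi.single_apply]; split_ifs <;> simp
  | .inr false => simp [passed]
  | .inr true => simp [passed]

theorem map_interference (a : S → R) (t t' : S ⊕ Bool) :
    φ (interference a t t') = interference (φ ∘ a) t t' := by
  rcases t with l | (_ | _) <;> rcases t' with j | (_ | _) <;>
    simp [interference, diffProd, diffProdErase]

theorem map_feature (p : S ⊕ (S ⊕ Bool) → R) (t : S ⊕ Bool) (c : S ⊕ (S ⊕ Bool)) :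
    φ (feature p t c) = feature (φ ∘ p) t c := by
  match c with
  | .inl i =>
    simp [feature, Matrix.vecMul, dotProduct, map_block, map_passed, Function.comp_assoc]
  | .inr t' => simp [feature, map_interference, Function.comp_assoc]

theorem map_det_featureMatrix {r : ℕ} (p : Fin r → S ⊕ (S ⊕ Bool) → R) (t : S ⊕ Bool)
    (Q : Finset (S ⊕ (S ⊕ Bool))) (e : Q → Fin r) :
    φ (featureMatrix p t Q e).det = (featureMatrix (fun m => φ ∘ p m) t Q e).det := by
  rw [RingHom.map_det]
  congr 1
  ext c c'
  simp [featureMatrix, map_feature]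

theorem map_det_blockMatrix {r : ℕ} (p : Fin r → S ⊕ (S ⊕ Bool) → R)
    (Q : Finset (S ⊕ Bool)) (e : Q → Fin r) :
    φ (blockMatrix p Q e).det = (blockMatrix (fun m => φ ∘ p m) Q e).det := by
  rw [RingHom.map_det]
  congr 1
  ext c c'
  simp [blockMatrix, map_block, Function.comp_assoc]

end Naturality

end Blocks

/-! ### Parameters at which a single determinant is nonzero. -/

section Points

variable {F : Type*} [Field F] {S : Type*} [Fintype S] [DecidableEq S]

theorem diffProd_ne_zero {a : S → F} (ha : Function.Injective a) (j : S) : diffProd a j ≠ 0 :=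
  Finset.prod_ne_zero_iff.2 fun _ hi => sub_ne_zero.2 fun e => (Finset.mem_erase.1 hi).1 (ha e).symm

theorem diffProdErase_ne_zero {a : S → F} (ha : Function.Injective a) (j i : S) :
    diffProdErase a j i ≠ 0 :=
  Finset.prod_ne_zero_iff.2 fun _ hi => sub_ne_zero.2 fun e =>
    (Finset.mem_erase.1 (Finset.mem_erase.1 hi).2).1 (ha e).symm

/-- In block `j` the rows other than `j` are diagonal, forcing a kernel vector to be supported at
`j`; row `j` then kills it through `diffProd a j`. -/
theorem det_block_ne_zero {a : S → F} (ha : Function.Injective a) (h0 : ∀ i, a i ≠ 0)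
    (t : S ⊕ Bool) : (block a t).det ≠ 0 := by
  match t with
  | .inl j =>
    intro hdet
    obtain ⟨v, hv, hv0⟩ := Matrix.exists_mulVec_eq_zero_iff.2 hdet
    have hne : ∀ i, i ≠ j → v i = 0 := by
      intro i hi
      have := congrFun hv0 i
      simpa [Matrix.mulVec, dotProduct, block, hi, h0 j, diffProdErase_ne_zero ha] using this
    refine hv (funext fun i => ?_)
    by_cases hi : i = j
    · subst hi
      have := congrFun hv0 i
      simp only [Matrix.mulVec, dotProduct] at this
      rw [Finset.sum_eq_single i (fun b _ hb => by simp [hne b hb]) (by simp)] at this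
      simpa [block, diffProd_ne_zero ha] using this
    · exact hne i hi
  | .inr false =>
    simp only [block, Matrix.det_diagonal]
    exact Finset.prod_ne_zero_iff.2 fun i _ => Finset.prod_ne_zero_iff.2 fun i' _ => h0 i'
  | .inr true => simp [block]

/-- Each coordinate of the passed symbols is the only nonzero one for suitable parameters. -/
theorem exists_feature_ne_zero_iff {b : S → F} (hb : Function.Injective b) (h0 : ∀ i, b i ≠ 0)
    (t : S ⊕ Bool) (c : S ⊕ (S ⊕ Bool)) (hc : c ≠ .inr t) :
    ∃ p : S ⊕ (S ⊕ Bool) → F, ∀ c', c' ≠ .inr t → (feature p t c' ≠ 0 ↔ c' = c) := by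
  -- The scalars act as switches: only the block of `u` is turned on.
  suffices H : ∃ (a : S → F) (u : S ⊕ Bool), ∀ c', c' ≠ .inr t →
      (feature (Sum.elim a (Pi.single u 1)) t c' ≠ 0 ↔ c' = c) by
    obtain ⟨a, u, h⟩ := H
    exact ⟨_, h⟩
  match c with
  | .inr t' =>
    refine ⟨b, t', ?_⟩
    have ht : t ≠ t' := fun e => hc (by rw [e])
    rintro (i | u) hu
    · simp [feature, ht]
    · by_cases hut : u = t'
      · subst hut
        simp only [feature, Sum.elim_inr, Sum.elim_comp_inl, Pi.single_eq_same, one_mul, ne_eq,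
          iff_true]
        rcases t with l | (_ | _) <;> rcases u with j | (_ | _) <;>
          simp [interference, diffProd_ne_zero hb, diffProdErase_ne_zero hb, h0,
            Finset.prod_eq_zero_iff]
      · simp [feature, hut]
  | .inl i₀ =>
    suffices H : ∃ a : S → F, ∀ i, Matrix.vecMul (passed a t) (block a t) i ≠ 0 ↔ i = i₀ by
      obtain ⟨a, ha⟩ := H
      refine ⟨a, t, ?_⟩
      rintro (i | u) hu
      · simpa [feature] using ha i
      · have : u ≠ t := fun e => hu (by rw [e])
        simp [feature, this]
    match t with
    | .inl l =>
      by_cases hi₀ : i₀ = l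
      · subst hi₀
        -- Off the diagonal, row `l` of block `l` has the factor `a l`, which is made zero.
        refine ⟨Function.update b i₀ 0, fun i => ?_⟩
        by_cases hi : i = i₀
        · subst hi
          simp only [passed, block, Matrix.single_one_vecMul, Matrix.row_apply, Matrix.of_apply,
            if_true, iff_true]
          refine Finset.prod_ne_zero_iff.2 fun i' hi' => ?_
          simp [(Finset.mem_erase.1 hi').1, h0]
        · simp [passed, block, hi]
      -- With `a l = a i₀`, the vanishing factor `a l - a i₀` occurs in every entry of row `l`
      -- except the one in column `i₀`.
      · refine ⟨Function.update b l (b i₀), fun i => ?_⟩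
        by_cases hil : i = l
        · subst hil
          simp only [passed, block, Matrix.single_one_vecMul, Matrix.row_apply, Matrix.of_apply,
            if_true, Ne.symm hi₀, iff_false, not_not]
          exact Finset.prod_eq_zero (i := i₀) (by simp [hi₀]) (by simp [hi₀])
        · simp only [passed, block, Matrix.single_one_vecMul, Matrix.row_apply, Matrix.of_apply,
            if_true, hil, if_false]
          by_cases hi : i = i₀
          · subst hi
            simp only [ne_eq, neg_eq_zero, mul_eq_zero, Function.update_self, h0, false_or,
              iff_true]
            refine Finset.prod_ne_zero_iff.2 fun i' hi' => ?_
            simp only [Finset.mem_erase] at hi'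
            rw [Function.update_self, Function.update_of_ne hi'.2.1]
            exact sub_ne_zero.2 fun e => hi'.1 (hb e).symm
          · simp only [hi, iff_false, not_not, neg_eq_zero]
            refine mul_eq_zero_of_right _ (Finset.prod_eq_zero (i := i₀) ?_ ?_)
            · simp [hi₀, Ne.symm hi]
            · simp [hi₀]
    | .inr false =>
      refine ⟨Function.update 1 i₀ 0, fun i => ?_⟩
      simp only [passed, block, Matrix.vecMul_diagonal, Pi.one_apply, one_mul]
      rw [Finset.prod_ne_zero_iff]
      constructor
      · intro h
        by_contra hi
        exact h i₀ (by simp [Ne.symm hi]) (by simp)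
      · rintro rfl i' hi'
        simp [(Finset.mem_erase.1 hi').1]
    | .inr true =>
      refine ⟨Pi.single i₀ 1, fun i => ?_⟩
      simp [passed, block, Pi.single_apply]

/-- Letting node `e c` single out coordinate `c` makes the matrix diagonal. Nodes outside the range
of `e` do not occur in it, so their value `0` is harmless. -/
theorem exists_det_featureMatrix_ne_zero {b : S → F} (hb : Function.Injective b)
    (h0 : ∀ i, b i ≠ 0) {r : ℕ} (t : S ⊕ Bool) (Q : Finset (S ⊕ (S ⊕ Bool)))
    (hQ : Sum.inr t ∉ Q) (e : Q ↪ Fin r) :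
    ∃ p : Fin r → S ⊕ (S ⊕ Bool) → F, (featureMatrix p t Q e).det ≠ 0 := by
  have hne : ∀ c : Q, (c : S ⊕ (S ⊕ Bool)) ≠ .inr t := fun c h => hQ (h ▸ c.2)
  choose p hp using fun c : Q => exists_feature_ne_zero_iff hb h0 t c (hne c)
  refine ⟨Function.extend e p 0, ?_⟩
  have : featureMatrix (Function.extend e p 0) t Q e =
      Matrix.diagonal fun c => feature (p c) t c := by
    ext c c'
    simp only [featureMatrix, Matrix.of_apply, e.injective.extend_apply, Matrix.diagonal_apply]
    split_ifs with h
    · rw [h]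
    · by_contra h'
      exact h (Subtype.ext ((hp c c' (hne c')).1 h')).symm
  rw [this, Matrix.det_diagonal]
  exact Finset.prod_ne_zero_iff.2 fun c _ => (hp c c (hne c)).2 rfl

/-- Node `e q` switches on block `q` alone, which leaves a block diagonal matrix. -/
theorem exists_det_blockMatrix_ne_zero {b : S → F} (hb : Function.Injective b)
    (h0 : ∀ i, b i ≠ 0) {r : ℕ} (Q : Finset (S ⊕ Bool)) (e : Q ↪ Fin r) :
    ∃ p : Fin r → S ⊕ (S ⊕ Bool) → F, (blockMatrix p Q e).det ≠ 0 := by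
  refine ⟨Function.extend e (fun q => Sum.elim b (Pi.single (q : S ⊕ Bool) 1)) 0, ?_⟩
  have : blockMatrix (Function.extend e (fun q => Sum.elim b (Pi.single (q : S ⊕ Bool) 1)) 0) Q e
      = Matrix.blockDiagonal fun q : Q => block b q := by
    ext ⟨i, q⟩ ⟨i', q'⟩
    simp only [blockMatrix, Matrix.of_apply, e.injective.extend_apply,
      Matrix.blockDiagonal_apply, Sum.elim_inr, Sum.elim_comp_inl]
    split_ifs with h
    · subst h; simp
    · have : (q' : S ⊕ Bool) ≠ q := fun h' => h (Subtype.ext h').symm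
      simp [this]
  rw [this, Matrix.det_blockDiagonal]
  exact Finset.prod_ne_zero_iff.2 fun q _ => det_block_ne_zero hb h0 q

end Points

/-- Over every large finite field there are parameters for which no determinant relevant for
regeneration or reconstruction vanishes. -/
theorem exists_generic_parameters (S : Type) [Fintype S] [DecidableEq S] (r : ℕ) :
    ∃ q₀ : ℕ, ∀ (F : Type*) [Field F] [Fintype F], q₀ ≤ Fintype.card F →
      ∃ p : Fin r → S ⊕ (S ⊕ Bool) → F,
        (∀ t (Q : Finset (S ⊕ (S ⊕ Bool))) (e : Q ↪ Fin r), Sum.inr t ∉ Q →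
          (featureMatrix p t Q e).det ≠ 0) ∧
        ∀ (Q : Finset (S ⊕ Bool)) (e : Q ↪ Fin r), (blockMatrix p Q e).det ≠ 0 := by
  let X : Fin r → S ⊕ (S ⊕ Bool) → MvPolynomial (Fin r × (S ⊕ (S ⊕ Bool))) ℤ :=
    fun m x => MvPolynomial.X (m, x)
  let ι := (Σ t : S ⊕ Bool, Σ Q : {Q : Finset (S ⊕ (S ⊕ Bool)) // Sum.inr t ∉ Q}, Q.1 ↪ Fin r) ⊕
    (Σ Q : Finset (S ⊕ Bool), Q ↪ Fin r)
  let P : ι → MvPolynomial (Fin r × (S ⊕ (S ⊕ Bool))) ℤ :=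
    Sum.elim (fun c => (featureMatrix X c.1 c.2.1.1 c.2.2).det)
      (fun c => (blockMatrix X c.1 c.2).det)
  obtain ⟨q₀, hq₀⟩ := exists_point_forall_eval_ne_zero P
  -- The second bound leaves room for `card S` distinct nonzero elements of `F`.
  refine ⟨max q₀ (Fintype.card S + 1), fun F _ _ hF => ?_⟩
  classical
  have hX : ∀ x : Fin r × (S ⊕ (S ⊕ Bool)) → F,
      (fun m => MvPolynomial.eval₂Hom (Int.castRingHom F) x ∘ X m) = fun m y => x (m, y) := by
    intro x
    ext m y
    simp [X]
  have hf : ∀ (x : Fin r × (S ⊕ (S ⊕ Bool)) → F) t (Q : Finset (S ⊕ (S ⊕ Bool))) (e : Q ↪ Fin r),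
      MvPolynomial.eval₂ (Int.castRingHom F) x (featureMatrix X t Q e).det =
        (featureMatrix (fun m y => x (m, y)) t Q e).det := fun x t Q e => by
    rw [← hX, ← map_det_featureMatrix]; rfl
  have hg : ∀ (x : Fin r × (S ⊕ (S ⊕ Bool)) → F) (Q : Finset (S ⊕ Bool)) (e : Q ↪ Fin r),
      MvPolynomial.eval₂ (Int.castRingHom F) x (blockMatrix X Q e).det =
        (blockMatrix (fun m y => x (m, y)) Q e).det := fun x Q e => by
    rw [← hX, ← map_det_blockMatrix]; rfl
  obtain ⟨b, hb, h0⟩ : ∃ b : S → F, Function.Injective b ∧ ∀ i, b i ≠ 0 := by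
    have hcard : Fintype.card S ≤ Fintype.card {x : F // x ≠ 0} := by
      rw [Fintype.card_subtype_compl, Fintype.card_subtype_eq]
      have := (le_max_right _ _).trans hF
      omega
    obtain ⟨g⟩ := Function.Embedding.nonempty_of_card_le hcard
    exact ⟨fun i => g i, fun i j h => g.injective (Subtype.ext h), fun i => (g i).2⟩
  obtain ⟨x, hx⟩ := hq₀ F ((le_max_left _ _).trans hF) (by
    rintro (⟨t, ⟨Q, hQ⟩, e⟩ | ⟨Q, e⟩)
    · obtain ⟨p, hp⟩ := exists_det_featureMatrix_ne_zero hb h0 t Q hQ e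
      refine ⟨fun y => p y.1 y.2, ?_⟩
      simpa only [P, Sum.elim_inl, hf] using hp
    · obtain ⟨p, hp⟩ := exists_det_blockMatrix_ne_zero hb h0 Q e
      refine ⟨fun y => p y.1 y.2, ?_⟩
      simpa only [P, Sum.elim_inr, hg] using hp)
  refine ⟨fun m y => x (m, y), fun t Q e hQ => ?_, fun Q e => ?_⟩
  · simpa only [P, Sum.elim_inl, hf] using hx (.inl ⟨t, ⟨Q, hQ⟩, e⟩)
  · simpa only [P, Sum.elim_inr, hg] using hx (.inr ⟨Q, e⟩)

/-! ### Reconstruction as a kernel condition, and splitting into chunks. -/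

section Codes

variable {F : Type*} [Field F] {k r : ℕ} {S T : Type*} [Fintype S]

theorem stackedMatrix_mulVec_eq_zero_iff (G : Code F k r S) (K : Finset (Node k r))
    (v : Fin k × S → F) :
    (stackedMatrix G K).mulVec v = 0 ↔
      ∀ m ∈ K, ∀ s, ∑ j, ∑ s', G m j s s' * v (j, s') = 0 := by
  simp [funext_iff, Matrix.mulVec, dotProduct, stackedMatrix, nodeMatrix,
    Fintype.sum_prod_type]

theorem reconstructs_iff (G : Code F k r S) :
    Reconstructs G ↔ ∀ K : Finset (Node k r), K.card = k → ∀ v : Fin k × S → F,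
      (∀ m ∈ K, ∀ s, ∑ j, ∑ s', G m j s s' * v (j, s') = 0) → v = 0 := by
  refine forall₂_congr fun K _ => ?_
  simp only [← stackedMatrix_mulVec_eq_zero_iff]
  have hrn := LinearMap.finrank_range_add_finrank_ker (stackedMatrix G K).mulVecLin
  rw [Module.finrank_fintype_fun_eq_card, Fintype.card_prod, Fintype.card_fin] at hrn
  change (stackedMatrix G K).rank + _ = _ at hrn
  have hker : (stackedMatrix G K).rank = k * Fintype.card S ↔
      (stackedMatrix G K).mulVecLin.ker = ⊥ := by
    rw [← Submodule.finrank_eq_zero (R := F)]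
    omega
  rw [hker, LinearMap.ker_eq_bot']
  rfl

theorem reconstructs_chunk {G : Code F k r S} (h : Reconstructs G) (β : ℕ) :
    Reconstructs (chunk β G) := by
  rw [reconstructs_iff] at h ⊢
  intro K hK v hv
  have key : ∀ b, (fun x : Fin k × S => v (x.1, (b, x.2))) = 0 := by
    intro b
    refine h K hK _ fun m hm s => ?_
    have := hv m hm (b, s)
    simpa [chunk, Fintype.sum_prod_type, Matrix.one_apply] using this
  ext ⟨j, b, s⟩
  exact congrFun (key b) (j, s)

omit [Fintype S] in
theorem isSystematic_chunk [DecidableEq S] {G : Code F k r S} (h : IsSystematic G) (β : ℕ) :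
    IsSystematic (chunk β G) := by
  intro m l
  simp only [chunk, h m l]
  split_ifs
  · exact Matrix.one_kronecker_one
  · exact Matrix.kronecker_zero _

theorem regeneratesSystematic_chunk [Fintype T] {G : Code F k r S} {X : Passing F k r S T} {d : ℕ}
    (h : RegeneratesSystematic G X d) (β : ℕ) :
    RegeneratesSystematic (chunk β G) (chunkPassing β X) d := by
  intro l D hD hl
  obtain ⟨Y, hY⟩ := h l D hD hl
  refine ⟨fun m => Matrix.kroneckerMap (· * ·) (1 : Matrix (Fin β) (Fin β) F) (Y m), ?_⟩
  ext ⟨b, s⟩ ⟨j, b', s'⟩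
  have key := congrFun (congrFun hY s) (j, s')
  rw [Matrix.sum_apply] at key ⊢
  have : ∀ m, (Matrix.kroneckerMap (· * ·) (1 : Matrix (Fin β) (Fin β) F) (Y m) *
      (chunkPassing β X m l * nodeMatrix (chunk β G) m)) (b, s) (j, (b', s')) =
      (1 : Matrix (Fin β) (Fin β) F) b b' * (Y m * (X m l * nodeMatrix G m)) s (j, s') := by
    intro m
    simp [Matrix.mul_apply, Fintype.sum_prod_type, chunkPassing, chunk, nodeMatrix,
      Matrix.one_apply]
  simp only [this, ← Finset.mul_sum, key]
  rfl

theorem isOptimalExactRegenerating_chunk [DecidableEq S] [Fintype T] {G : Code F k r S}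
    {X : Passing F k r S T} {d : ℕ} (h : IsOptimalExactRegenerating G X d) (β : ℕ) :
    IsOptimalExactRegenerating (chunk β G) (chunkPassing β X) d := by
  obtain ⟨h1, h2, h3, h4⟩ := h
  refine ⟨isSystematic_chunk h1 β, reconstructs_chunk h2 β, regeneratesSystematic_chunk h3 β, ?_⟩
  simp only [Fintype.card_prod, Fintype.card_fin]
  linear_combination β * h4

end Codes

/-! ### Reconstruction and regeneration for the aligned code. -/

section Construction

variable {F : Type*} [Field F] {k r : ℕ} {S : Type*} [Fintype S] [DecidableEq S]

/-- The code with parameters `p m` at the non-systematic nodes `m`. -/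
def alignedCode (ι : Fin k → S ⊕ Bool) (p : Fin r → S ⊕ (S ⊕ Bool) → F) : Code F k r S
  | .inl m, l => if l = m then 1 else 0
  | .inr m, j => p m (.inr (ι j)) • block (p m ∘ .inl) (ι j)

/-- The passed coefficients for `alignedCode`. -/
def alignedPassing (ι : Fin k → S ⊕ Bool) (p : Fin r → S ⊕ (S ⊕ Bool) → F) :
    Passing F k r S (Fin 1)
  | .inl j, l => Matrix.of fun _ => direction (ι l) (ι j)
  | .inr m, l => Matrix.of fun _ => passed (p m ∘ .inl) (ι l)

theorem isSystematic_alignedCode (ι : Fin k → S ⊕ Bool) (p : Fin r → S ⊕ (S ⊕ Bool) → F) :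
    IsSystematic (alignedCode ι p) := fun _ _ => rfl

theorem card_toLeft_compl (K : Finset (Node k r)) : K.toLeft.card + K.toLeftᶜ.card = k := by
  rw [Finset.card_add_card_compl, Fintype.card_fin]

/-- Systematic nodes in `K` kill their own coordinates. As `K` has `k` elements, the missing
systematic nodes are as many as the non-systematic ones in `K`, so the rest is a square system with
matrix `blockMatrix`. -/
theorem reconstructs_alignedCode {ι : Fin k → S ⊕ Bool} (hι : Function.Injective ι)
    {p : Fin r → S ⊕ (S ⊕ Bool) → F}
    (hp : ∀ (Q : Finset (S ⊕ Bool)) (e : Q ↪ Fin r), (blockMatrix p Q e).det ≠ 0) :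
    Reconstructs (alignedCode ι p) := by
  rw [reconstructs_iff]
  intro K hK v hv
  have hsys : ∀ j, Sum.inl j ∈ K → ∀ s, v (j, s) = 0 := by
    intro j hj s
    have := hv _ hj s
    rw [Finset.sum_eq_single j (fun b _ hb => by simp [alignedCode, hb]) (by simp)] at this
    simpa [alignedCode, Matrix.one_apply] using this
  let Q : Finset (S ⊕ Bool) := K.toLeftᶜ.image ι
  have hcard : Q.card = K.toRight.card := by
    have h1 := card_toLeft_compl K
    have h2 := Finset.card_toLeft_add_card_toRight (u := K)
    rw [Finset.card_image_of_injective _ hι]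
    omega
  let E : Q ≃ K.toRight := Finset.equivOfCardEq hcard
  let e : Q ↪ Fin r := E.toEmbedding.trans (Function.Embedding.subtype _)
  let g : (K.toLeftᶜ : Finset (Fin k)) ≃ Q :=
    Equiv.ofBijective (fun j => ⟨ι j, Finset.mem_image_of_mem _ j.2⟩)
      ⟨fun i j h => Subtype.ext (hι (congrArg Subtype.val h)), fun q => by
        obtain ⟨j, hj, h⟩ := Finset.mem_image.1 q.2
        exact ⟨⟨j, hj⟩, Subtype.ext h⟩⟩
  let w : S × Q → F := fun x => v ((g.symm x.2 : Fin k), x.1)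
  have hw : ∀ (j : (K.toLeftᶜ : Finset (Fin k))) (s : S), w (s, g j) = v (j, s) := by
    intro j s
    simp [w]
  have hmul : (blockMatrix p Q e).mulVec w = 0 := by
    ext ⟨s, q⟩
    have hm : Sum.inr (e q) ∈ K := Finset.mem_toRight.1 (E q).2
    have := hv _ hm s
    rw [← Finset.sum_subset (Finset.subset_univ K.toLeftᶜ) (fun j _ hj => by
      refine Finset.sum_eq_zero fun s' _ => ?_
      rw [hsys j (by simpa using hj), mul_zero]), ← Finset.sum_coe_sort] at this
    rw [Pi.zero_apply, ← this]
    simp only [Matrix.mulVec, dotProduct]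
    rw [Fintype.sum_prod_type_right]
    refine (Fintype.sum_equiv g _ _ fun j => Finset.sum_congr rfl fun s' _ => ?_).symm
    rw [hw]
    rfl
  have hw0 : w = 0 := Matrix.eq_zero_of_mulVec_eq_zero (hp Q e) hmul
  ext ⟨j, s⟩
  by_cases hj : Sum.inl j ∈ K
  · exact hsys j hj s
  · rw [← hw ⟨j, by simpa using hj⟩, hw0]
    rfl

theorem alignedPassing_mul_nodeMatrix_inr {ι : Fin k → S ⊕ Bool} (hι : Function.Injective ι)
    (p : Fin r → S ⊕ (S ⊕ Bool) → F) (m : Fin r) (l : Fin k) (x : Fin 1) (j : Fin k) (s : S) :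
    (alignedPassing ι p (.inr m) l * nodeMatrix (alignedCode ι p) (.inr m)) x (j, s) =
      if j = l then feature (p m) (ι l) (.inl s)
      else feature (p m) (ι l) (.inr (ι j)) * direction (ι l) (ι j) s := by
  have h : (alignedPassing ι p (.inr m) l * nodeMatrix (alignedCode ι p) (.inr m)) x (j, s) =
      p m (.inr (ι j)) * Matrix.vecMul (passed (p m ∘ .inl) (ι l))
        (block (p m ∘ .inl) (ι j)) s := by
    simp only [Matrix.mul_apply, alignedPassing, alignedCode, nodeMatrix, Matrix.of_apply,
      Matrix.vecMul, dotProduct, Matrix.smul_apply, smul_eq_mul, Finset.mul_sum]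
    exact Finset.sum_congr rfl fun _ _ => by ring
  rw [h]
  split_ifs with hj
  · rw [hj]; rfl
  · rw [passed_vecMul_block _ (hι.ne (Ne.symm hj)), Pi.smul_apply, smul_eq_mul, ← mul_assoc]
    rfl

theorem alignedPassing_mul_nodeMatrix_inl (ι : Fin k → S ⊕ Bool)
    (p : Fin r → S ⊕ (S ⊕ Bool) → F) (m : Fin k) (l : Fin k) (x : Fin 1) (j : Fin k) (s : S) :
    (alignedPassing ι p (.inl m) l * nodeMatrix (alignedCode ι p) (.inl m)) x (j, s) =
      if j = m then direction (ι l) (ι j) s else 0 := by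
  simp only [Matrix.mul_apply, alignedPassing, alignedCode, nodeMatrix, Matrix.of_apply]
  split_ifs with hj
  · subst hj; simp [Matrix.one_apply]
  · simp

theorem regeneratesSystematic_alignedCode {ι : Fin k → S ⊕ Bool} (hι : Function.Injective ι)
    {p : Fin r → S ⊕ (S ⊕ Bool) → F}
    (hp : ∀ t (Q : Finset (S ⊕ (S ⊕ Bool))) (e : Q ↪ Fin r), Sum.inr t ∉ Q →
      (featureMatrix p t Q e).det ≠ 0)
    {d : ℕ} (hd : d + 1 = Fintype.card S + k) :
    RegeneratesSystematic (alignedCode ι p) (alignedPassing ι p) d := by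
  intro l D hD hl
  let A : Finset (Fin k) := D.toLeftᶜ.erase l
  -- The unknowns: all desired coordinates, and one interference for each systematic node other than
  -- `l` that is not a helper.
  let Q : Finset (S ⊕ (S ⊕ Bool)) := Finset.univ.disjSum (A.image ι)
  have hlQ : Sum.inr (ι l) ∉ Q := by
    simp [Q, A, hι.eq_iff]
  have hcard : Q.card = D.toRight.card := by
    have h1 := card_toLeft_compl D
    have h2 := Finset.card_toLeft_add_card_toRight (u := D)
    have h3 : A.card + 1 = D.toLeftᶜ.card := Finset.card_erase_add_one (by simpa using hl)
    rw [Finset.card_disjSum, Finset.card_image_of_injective _ hι, Finset.card_univ]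
    omega
  let E : Q ≃ D.toRight := Finset.equivOfCardEq hcard
  let e : Q ↪ Fin r := E.toEmbedding.trans (Function.Embedding.subtype _)
  let N := featureMatrix p (ι l) Q e
  have hN : N⁻¹ * N = 1 := Matrix.nonsing_inv_mul _ (hp _ Q e hlQ).isUnit
  let q : S → Q := fun i => ⟨.inl i, by simp [Q]⟩
  let y : S → Fin r → F := fun i m =>
    if h : m ∈ D.toRight then N⁻¹ (q i) (E.symm ⟨m, h⟩) else 0
  have hy : ∀ i (c : Q), ∑ m ∈ D.toRight, y i m * feature (p m) (ι l) c =
      (1 : Matrix Q Q F) (q i) c := by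
    intro i c
    rw [← hN, Matrix.mul_apply, ← Finset.sum_coe_sort]
    refine (Fintype.sum_equiv E _ _ fun c' => ?_).symm
    simp only [y, Finset.coe_mem, dif_pos, Subtype.coe_eta, Equiv.symm_apply_apply]
    rfl
  -- Systematic helper `j` passes precisely the aligned direction, so this multiple of it cancels
  -- the interference of `j`.
  let z : S → Fin k → F := fun i j => -∑ m ∈ D.toRight, y i m * feature (p m) (ι l) (.inr (ι j))
  refine ⟨Sum.elim (fun j => Matrix.of fun i _ => z i j) (fun m => Matrix.of fun i _ => y i m), ?_⟩
  ext i ⟨j, s⟩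
  rw [Matrix.sum_apply, Finset.sum_sum_eq_sum_toLeft_add_sum_toRight]
  have hcol : ∀ (f : S → F) (B : Matrix (Fin 1) (Fin k × S) F),
      ((Matrix.of fun i _ => f i : Matrix S (Fin 1) F) * B) i (j, s) = f i * B 0 (j, s) :=
    fun f B => by simp [Matrix.mul_apply]
  simp only [Sum.elim_inl, Sum.elim_inr, hcol,
    alignedPassing_mul_nodeMatrix_inr hι, alignedPassing_mul_nodeMatrix_inl]
  by_cases hj : j = l
  · subst hj
    have h1 : ∀ x ∈ D.toLeft, z i x * (if j = x then direction (ι j) (ι j) s else 0) = 0 := by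
      intro x hx
      have : j ≠ x := fun h => hl (h ▸ Finset.mem_toLeft.1 hx)
      simp [this]
    rw [Finset.sum_eq_zero h1, zero_add]
    simp only [if_true]
    rw [hy i (q s)]
    simp [nodeMatrix, alignedCode, Matrix.one_apply, q]
  · simp only [hj, if_false, ← mul_assoc]
    rw [← Finset.sum_mul]
    simp only [mul_ite, mul_zero, Finset.sum_ite_eq]
    have hrhs : nodeMatrix (alignedCode ι p) (.inl l) i (j, s) = 0 := by
      simp [nodeMatrix, alignedCode, hj]
    rw [hrhs]
    by_cases hjD : j ∈ D.toLeft
    · simp [hjD, z]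
    -- The interference of a non-helper is a column of `N`, hence cancelled by the choice of `y`.
    · have hjQ : Sum.inr (ι j) ∈ Q := by
        simp only [Q, A, Finset.inr_mem_disjSum]
        exact Finset.mem_image_of_mem _ (by simpa [hj] using hjD)
      have := hy i ⟨_, hjQ⟩
      simp only at this
      rw [this]
      simp [hjD, q]

end Construction

/-! ### Indexing the systematic nodes and the required structure of the code. -/

/-- The inclusion of `k ≤ α + 2` systematic nodes into the index set of the construction. -/
def nodeIndex {α k : ℕ} (j : Fin k) : Fin α ⊕ Bool :=
  if h : (j : ℕ) < α then .inl ⟨j, h⟩ else .inr (decide ((j : ℕ) = α))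

theorem nodeIndex_injective {α k : ℕ} (h : k ≤ α + 2) :
    Function.Injective (nodeIndex : Fin k → Fin α ⊕ Bool) := by
  intro i j hij
  ext
  have hi := i.2
  have hj := j.2
  simp only [nodeIndex] at hij
  split_ifs at hij with h1 h2 h2
  · simpa using hij
  · simp only [Sum.inr.injEq, decide_eq_decide] at hij
    omega

theorem nodeIndex_eq_inl {α k : ℕ} {j : Fin k} {i : Fin α} (h : (i : ℕ) = j) :
    nodeIndex j = .inl i := by
  simp [nodeIndex, ← h]

/-- Away from the rows with equal indices, the blocks are diagonal. -/
theorem block_nodeIndex_apply {R : Type*} [CommRing R] {α k : ℕ} (a : Fin α → R) {j : Fin k}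
    {i i' : Fin α} (hij : (i : ℕ) ≠ j) (hi : i' ≠ i) : block a (nodeIndex j) i i' = 0 := by
  unfold nodeIndex
  split_ifs with h
  · have : i ≠ ⟨j, h⟩ := fun e => hij (by rw [e])
    simp [block, this, hi]
  · cases decide ((j : ℕ) = α) <;> simp [block, hi.symm]

theorem hasAlignedStructure_alignedCode {F : Type*} [Field F] {k r α : ℕ}
    (p : Fin r → Fin α ⊕ (Fin α ⊕ Bool) → F) :
    HasAlignedStructure (alignedCode (nodeIndex : Fin k → _) p) (alignedPassing nodeIndex p) := by
  -- For `i ≠ j` row `i` of the block is a multiple of the unit vector `e_i`: the multiple goes into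
  -- `Λ`, and `e_i`, the same for all `m`, into `H`. The row `i = j` goes into `H` whole.
  refine ⟨fun m j i => if (i : ℕ) = j then 1 else alignedCode nodeIndex p (.inr m) j i i,
    fun m j => Matrix.of fun i =>
      if (i : ℕ) = j then alignedCode nodeIndex p (.inr m) j i else Pi.single i 1,
    fun m j => ?_, fun m j i h => if_pos h, fun m m' j i h => ?_, fun m l i h => ?_⟩
  · ext i i'
    rw [Matrix.diagonal_mul]
    simp only [Matrix.of_apply]
    split_ifs with h
    · simp
    · by_cases hi : i' = i
      · subst hi; simp
      · simp [alignedCode, block_nodeIndex_apply _ h hi, hi]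
  · ext i'
    simp [h]
  · change passed _ (nodeIndex l) = _
    rw [nodeIndex_eq_inl h]
    rfl

end RegenCode

theorem mainTheorem3 (n k α d : ℕ) (hk : 1 ≤ k) (hα : 1 ≤ α) (hkα : k ≤ α + 2)
    (hd : d + 1 = α + k) (hn : d < n) :
    ∃ q₀ : ℕ, ∀ (F : Type*) [Field F] [Fintype F], q₀ ≤ Fintype.card F →
      ∃ (G : RegenCode.Code F k (n - k) (Fin α))
        (X : RegenCode.Passing F k (n - k) (Fin α) (Fin 1)),
        RegenCode.HasAlignedStructure G X ∧
        RegenCode.IsOptimalExactRegenerating G X d ∧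
        ∀ β : ℕ, 1 ≤ β →
          RegenCode.IsOptimalExactRegenerating (RegenCode.chunk β G)
            (RegenCode.chunkPassing β X) d := by
  obtain ⟨q₀, hq₀⟩ := RegenCode.exists_generic_parameters (Fin α) (n - k)
  refine ⟨q₀, fun F _ _ hF => ?_⟩
  obtain ⟨p, hp₁, hp₂⟩ := hq₀ F hF
  have hι := RegenCode.nodeIndex_injective hkα
  have hopt : RegenCode.IsOptimalExactRegenerating
      (RegenCode.alignedCode (RegenCode.nodeIndex : Fin k → _) p)
      (RegenCode.alignedPassing RegenCode.nodeIndex p) d :=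
    ⟨RegenCode.isSystematic_alignedCode _ p, RegenCode.reconstructs_alignedCode hι hp₂,
      RegenCode.regeneratesSystematic_alignedCode hι hp₁ (by rwa [Fintype.card_fin]),
      by simpa using hd⟩
  exact ⟨_, _, RegenCode.hasAlignedStructure_alignedCode p, hopt,
    fun β _ => RegenCode.isOptimalExactRegenerating_chunk hopt β⟩
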